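/- For a finite group $G$ with conjugacy classes $K_1,\dots,K_r$ and complex irreducible characters $\chi_1,\dots,\chi_r$, let $$h(G)=\frac{|K_1|\cdots|K_r|}{\chi_1(1)\cdots\chi_r(1)}$$ be Harada's number of $G$. Let $p$ be a prime. (1) Let $G$ be a finite $p$-group having a central subgroup $Z$ of order $p$ such that $G/Z$ is abelian. Write $|G/Z(G)|=p^s$ and $[s]_p=(p^s-1)/(p-1)$, where $Z(G)$ is the center of $G$. Then $$h(G)=p^{\frac{(p-1)(2[s]_p-s)}{2}\,|Z(G)/Z|}.$$ (2) For every integer $d>2$, the group $$M(p^d)=\langle x,y \mid x^{p^{d-1}}=y^p=1,\ y^{-1}xy=x^{1+p^{d-2}}\rangle$$ is finite, and $h(M(p^d))=p^{p^{d-2}(p-1)}$. -/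

import Mathlib

noncomputable section

/-- The set `Irr(G)` of complex irreducible characters of `G`. Every finite-dimensional complex
representation is isomorphic to one on some `ℂⁿ`, so it is enough to let those representations
range over the spaces `Fin n → ℂ`. -/
def irrChar (G : Type*) [Group G] : Set (G → ℂ) :=
  {χ | ∃ (n : ℕ) (ρ : Representation ℂ G (Fin n → ℂ)), ρ.IsIrreducible ∧ χ = ρ.character}

/-- A finite group has finitely many irreducible characters, so that the product of their degrees
is an honest finite product. -/
theorem irrChar_finite (G : Type*) [Group G] [Finite G] : (irrChar G).Finite := by
  classical
  have := Fintype.ofFinite G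
  have hc : (Nat.card G : ℂ) ≠ 0 := by
    exact_mod_cast (Nat.card_pos (α := G)).ne'
  let _ : Invertible (Nat.card G : ℂ) := invertibleOfNonzero hc
  have key : ∀ χ ∈ irrChar G, ∀ ψ ∈ irrChar G,
      ∑ g : G, χ g * ψ g⁻¹ = if χ = ψ then (Nat.card G : ℂ) else 0 := by
    rintro χ ⟨n, ρ, hρ, rfl⟩ ψ ⟨m, σ, hσ, rfl⟩
    have h := Representation.char_orthonormal ρ σ
    have h1 := Representation.char_orthonormal ρ ρ
    rw [if_pos ⟨Representation.Equiv.refl ρ⟩] at h1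
    split_ifs with he
    · rw [← he]
      field_simp at h1
      exact h1
    · rw [if_neg (fun ⟨e⟩ => he (Representation.char_iso e).symm)] at h
      simpa [hc] using h
  have li : LinearIndependent ℂ (fun χ : irrChar G => (χ : G → ℂ)) := by
    rw [linearIndependent_iff']
    intro s c hs ψ hψ
    have h2 : ∑ g : G, (∑ χ ∈ s, c χ • (χ : G → ℂ)) g * (ψ : G → ℂ) g⁻¹ = 0 := by
      rw [hs]; simp
    simp only [Finset.sum_apply, Pi.smul_apply, smul_eq_mul, Finset.sum_mul] at h2
    rw [Finset.sum_comm] at h2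
    simp only [mul_assoc, ← Finset.mul_sum] at h2
    rw [Finset.sum_congr rfl (fun χ _ => by rw [key χ χ.2 ψ ψ.2])] at h2
    simpa [Subtype.coe_inj, hψ, hc] using h2
  exact LinearIndependent.setFinite li

/-- Harada's number `h(G) = (|K₁| ⋯ |Kₛ|) / (χ₁(1) ⋯ χₛ(1))` of a finite group `G`: the product of
the sizes of all conjugacy classes, divided by the product of the degrees of all complex
irreducible characters (as a complex number, since characters are complex valued). -/
def haradaNumber (G : Type*) [Group G] : ℂ :=
  (∏ᶠ K : ConjClasses G, (Nat.card K.carrier : ℂ)) / ∏ᶠ χ ∈ irrChar G, χ 1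

/-- The real number `[s]_p = (p ^ s - 1) / (p - 1)`. -/
def pInt (p s : ℕ) : ℝ := ((p : ℝ) ^ s - 1) / ((p : ℝ) - 1)

/-- The group `M(p^d) = ⟨x, y | x ^ (p ^ (d - 1)) = y ^ p = 1, x ^ y = x ^ (1 + p ^ (d - 2))⟩`
(for `d > 2`), where `x ^ y = y⁻¹ x y`; the generators `x`, `y` are indexed by `0`, `1`. -/
abbrev ModularPGroup (p d : ℕ) : Type :=
  let x : FreeGroup (Fin 2) := FreeGroup.of 0
  let y : FreeGroup (Fin 2) := FreeGroup.of 1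
  PresentedGroup ({x ^ p ^ (d - 1), y ^ p, (y⁻¹ * x * y) * (x ^ (1 + p ^ (d - 2)))⁻¹} :
    Set (FreeGroup (Fin 2)))

end

/-! Since `G ⧸ Z` is abelian, commutation with a noncentral `g` is a homomorphism from `G` to `Z`,
surjective because `Z` has prime order. Hence the class of `g` is the coset `gZ`
(`card_carrier_of_mem_noncenter`), and counting elements gives the number of classes of size `p`.

An irreducible `χ` has a central character `l`. If `l` is trivial on `Z`, then `χ` factors through
the abelian group `G ⧸ Z` and is linear. Otherwise some `z` in `Z` has `l z ≠ 1`, and `χ(g) = χ(gz)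
= l(z) χ(g)` for noncentral `g`, so `χ` vanishes off the center (`character_eq_extendCentral`). It
is then determined by `l`, and `⟨χ, χ⟩ = 1` forces `χ(1)² = |G : Z(G)|` (`sq_mul_card_center`).
Every `l` occurs, so the product of degrees is a power counted by the characters of `Z(G)`
nontrivial on `Z` (`finprod_degree`).

For `M(p^d)` take `Z = ⟨x^q⟩` with `q = p^(d-2)`. The relations give a normal form `y^j x^i`; an
affine action on the integers mod `pq` shows that it is unique. So the order is `p^d`, the center
has index `p²`, and the formula applies with `s = 2`. -/

/-! ### Schur's lemma and central characters. -/

/-- The center acts on an irreducible representation through a linear character. -/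
theorem exists_centralCharacter {G : Type*} [Group G] {n : ℕ}
    (ρ : Representation ℂ G (Fin n → ℂ)) [ρ.IsIrreducible] :
    ∃ l : Subgroup.center G →* ℂˣ, ∀ z : Subgroup.center G, ρ z = (l z : ℂ) • 1 := by
  have hsurj := (Representation.IsIrreducible.algebraMap_intertwiningMap_bijective_of_isAlgClosed
    (ρ := ρ)).2
  have hscal : ∀ z : Subgroup.center G, ∃ c : ℂ, ρ z = c • 1 := by
    intro z
    have hz : (z : G) ∈ Submonoid.center G := z.2
    obtain ⟨c, hc⟩ := hsurj (Representation.IntertwiningMap.centralMul ρ (z : G) hz)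
    refine ⟨c, ?_⟩
    exact (congrArg Representation.IntertwiningMap.toLinearMap hc).symm
  have hnt : Nontrivial (Fin n → ℂ) := by
    by_contra h
    rw [not_nontrivial_iff_subsingleton] at h
    exact bot_ne_top (α := Subrepresentation ρ)
      (Subrepresentation.toSubmodule_injective (Subsingleton.elim _ _))
  choose c hc using hscal
  obtain ⟨v, hv⟩ := exists_ne (0 : Fin n → ℂ)
  have hinj : ∀ {a b : ℂ}, a • (1 : Module.End ℂ (Fin n → ℂ)) = b • 1 → a = b := fun h =>
    smul_left_injective ℂ hv (congrArg (fun f => f v) h)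
  let f : Subgroup.center G →* ℂ :=
    { toFun := c
      map_one' := hinj (by simp [← hc])
      map_mul' := fun a b => hinj (by
        simp only [← hc]
        rw [Subgroup.coe_mul, map_mul, hc, hc, smul_mul_smul_comm, one_mul]) }
  exact ⟨f.toHomUnits, fun z => hc z⟩

/-- Each operator is an intertwiner, hence scalar by Schur, so every subspace is invariant and
irreducibility becomes simplicity as a vector space. -/
theorem finrank_eq_one_of_forall_commute {G V : Type*} [Group G] [AddCommGroup V] [Module ℂ V]
    [FiniteDimensional ℂ V] (ρ : Representation ℂ G V) [ρ.IsIrreducible]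
    (h : ∀ a b, ρ a * ρ b = ρ b * ρ a) : Module.finrank ℂ V = 1 := by
  have hsurj := (Representation.IsIrreducible.algebraMap_intertwiningMap_bijective_of_isAlgClosed
    (ρ := ρ)).2
  have hscal : ∀ g, ∃ c : ℂ, ∀ v, ρ g v = c • v := by
    intro g
    obtain ⟨c, hc⟩ := hsurj ⟨ρ g, fun b => h g b⟩
    refine ⟨c, fun v => ?_⟩
    exact (congrArg (fun f => f v) (congrArg Representation.IntertwiningMap.toLinearMap hc)).symm
  rw [← isSimpleModule_iff_finrank_eq_one (R := ℂ), isSimpleModule_iff]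
  let e : Submodule ℂ V ≃o Subrepresentation ρ :=
    { toFun := fun W => ⟨W, fun g v hv => by
        obtain ⟨c, hc⟩ := hscal g
        rw [hc]
        exact W.smul_mem c hv⟩
      invFun := fun W => W.toSubmodule
      left_inv := fun _ => rfl
      right_inv := fun _ => rfl
      map_rel_iff' := Iff.rfl }
  exact e.isSimpleOrder_iff.2 inferInstance

/-- Every finite-dimensional representation can be moved to a coordinate space. -/
theorem exists_coordinate_representation {G V : Type*} [Group G] [AddCommGroup V] [Module ℂ V]
    [FiniteDimensional ℂ V] (σ : Representation ℂ G V) {l : Subgroup.center G →* ℂˣ}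
    (h : ∀ z : Subgroup.center G, ∀ v, σ z v = (l z : ℂ) • v) :
    ∃ ρ : Representation ℂ G (Fin (Module.finrank ℂ V) → ℂ),
      ∀ z : Subgroup.center G, ρ z = (l z : ℂ) • 1 := by
  have e : V ≃ₗ[ℂ] (Fin (Module.finrank ℂ V) → ℂ) := (Module.finBasis ℂ V).equivFun
  refine ⟨(e.conjRingEquiv : Module.End ℂ V →* _).comp σ, fun z => ?_⟩
  refine LinearMap.ext fun v => ?_
  simp [LinearEquiv.conjRingEquiv, h]

/-! ### Irreducible representations with a prescribed central character. -/

/-- The functions on `G` on which the center acts through the character `l`. -/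
def centralFunctions {G : Type*} [Group G] (l : Subgroup.center G →* ℂˣ) : Submodule ℂ (G → ℂ) where
  carrier := {f | ∀ (g : G) (z : Subgroup.center G), f (g * z) = l z * f g}
  add_mem' := fun ha hb g z => by simp [ha g z, hb g z, mul_add]
  zero_mem' := fun g z => by simp
  smul_mem' := fun c f hf g z => by simp [hf g z, mul_left_comm]

/-- Right translation on `centralFunctions l`. -/
def centralFunctionsRep {G : Type*} [Group G] (l : Subgroup.center G →* ℂˣ) :
    Representation ℂ G (centralFunctions l) where
  toFun h :=
    { toFun := fun f => ⟨fun g => f.1 (g * h), fun g z => by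
        beta_reduce
        rw [mul_assoc, ← (Subgroup.mem_center_iff.1 z.2 h), ← mul_assoc]
        exact f.2 (g * h) z⟩
      map_add' := fun _ _ => rfl
      map_smul' := fun _ _ => rfl }
  map_one' := by ext; simp
  map_mul' a b := by ext; simp [mul_assoc]

/-- The extension of `l` by zero off the center is a nonzero element. -/
theorem nontrivial_centralFunctions {G : Type*} [Group G] (l : Subgroup.center G →* ℂˣ) :
    Nontrivial (centralFunctions l) := by
  classical
  let f : G → ℂ := fun g => if h : g ∈ Subgroup.center G then l ⟨g, h⟩ else 0
  have hf : f ∈ centralFunctions l := by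
    intro g z
    by_cases hg : g ∈ Subgroup.center G
    · have hgz : g * z ∈ Subgroup.center G := mul_mem hg z.2
      have : (⟨g * z, hgz⟩ : Subgroup.center G) = z * ⟨g, hg⟩ :=
        Subtype.ext (Subgroup.mem_center_iff.1 z.2 g)
      simp only [f, dif_pos hg, dif_pos hgz, this, map_mul, Units.val_mul]
    · have hgz : g * z ∉ Subgroup.center G := fun h =>
        hg ((Subgroup.mul_mem_cancel_right _ z.2).1 h)
      simp only [f, dif_neg hg, dif_neg hgz, mul_zero]
  refine ⟨⟨⟨f, hf⟩, 0, fun h => ?_⟩⟩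
  have h1 := congrFun (congrArg Subtype.val h) 1
  have : f 1 = l 1 := by
    simp only [f, dif_pos (one_mem (Subgroup.center G))]
    rfl
  rw [show (⟨f, hf⟩ : centralFunctions l).1 1 = f 1 from rfl, this] at h1
  simp at h1

/-- Every linear character of the center is the central character of an irreducible
representation: one of least dimension among those on which the center acts through it. -/
theorem exists_irreducible_of_centralCharacter {G : Type*} [Group G] [Finite G]
    (l : Subgroup.center G →* ℂˣ) :
    ∃ (n : ℕ) (ρ : Representation ℂ G (Fin n → ℂ)), ρ.IsIrreducible ∧
      ∀ z : Subgroup.center G, ρ z = (l z : ℂ) • 1 := by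
  classical
  let P : ℕ → Prop := fun n => 0 < n ∧ ∃ ρ : Representation ℂ G (Fin n → ℂ),
    ∀ z : Subgroup.center G, ρ z = (l z : ℂ) • 1
  have hP : ∃ n, P n := by
    have := nontrivial_centralFunctions l
    exact ⟨_, Module.finrank_pos (R := ℂ) (M := centralFunctions l),
      exists_coordinate_representation (centralFunctionsRep l)
        (fun z f => Subtype.ext (funext fun g => f.2 g z))⟩
  obtain ⟨hn, ρ, hρ⟩ := Nat.find_spec hP
  refine ⟨Nat.find hP, ρ, ?_, hρ⟩
  have : Nontrivial (Fin (Nat.find hP) → ℂ) := by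
    have : Nonempty (Fin (Nat.find hP)) := ⟨⟨0, hn⟩⟩
    infer_instance
  have hbt : (⊥ : Subrepresentation ρ) ≠ ⊤ := fun h =>
    bot_ne_top (α := Submodule ℂ (Fin (Nat.find hP) → ℂ))
      (congrArg Subrepresentation.toSubmodule h)
  have : Nontrivial (Subrepresentation ρ) := ⟨⟨_, _, hbt⟩⟩
  refine ⟨fun S => or_iff_not_imp_left.2 fun hS => ?_⟩
  have hS' : S.toSubmodule ≠ ⊥ := fun h => hS (Subrepresentation.toSubmodule_injective h)
  have : Nontrivial S.toSubmodule := Submodule.nontrivial_iff_ne_bot.2 hS'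
  have hle : Nat.find hP ≤ Module.finrank ℂ S.toSubmodule :=
    Nat.find_min' hP ⟨Module.finrank_pos, exists_coordinate_representation S.toRepresentation
      (fun z v => Subtype.ext (by
        have := congrArg (fun f => f v.1) (hρ z)
        simpa [Subrepresentation.toRepresentation] using this))⟩
  apply Subrepresentation.toSubmodule_injective
  apply Submodule.eq_top_of_finrank_eq
  refine le_antisymm (Submodule.finrank_le _) ?_
  simpa using hle

/-! ### Conjugacy classes when `G ⧸ Z` is abelian. -/

/-- The conjugacy class of a noncentral element `g` contains the coset `g Z`. -/
theorem exists_conj_eq_mul {G : Type*} [Group G] {Z : Subgroup G} [Z.Normal]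
    (hZ : Z ≤ Subgroup.center G) (hp : (Nat.card Z).Prime) (hab : ∀ a b : G ⧸ Z, a * b = b * a)
    {g : G} (hg : g ∉ Subgroup.center G) {z : G} (hz : z ∈ Z) :
    ∃ h, h * g * h⁻¹ = g * z := by
  have hmem : ∀ h : G, g⁻¹ * (h * g * h⁻¹) ∈ Z := by
    intro h
    rw [← QuotientGroup.eq_one_iff]
    have := hab h g
    simp [this]
  -- Multiplicative because its values are central. Its range in a group of prime order is trivial
  -- or everything, and trivial would make `g` central.
  let f : G →* Z :=
    { toFun := fun h => ⟨g⁻¹ * (h * g * h⁻¹), hmem h⟩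
      map_one' := Subtype.ext (by simp)
      map_mul' := fun a b => Subtype.ext (by
        have h1 := Subgroup.mem_center_iff.1 (hZ (hmem b)) a
        simp only [Subgroup.coe_mul]
        calc g⁻¹ * (a * b * g * (a * b)⁻¹)
            = g⁻¹ * (a * g * (g⁻¹ * (b * g * b⁻¹)) * a⁻¹) := by group
          _ = g⁻¹ * (g * (g⁻¹ * (a * g * (g⁻¹ * (b * g * b⁻¹)) * a⁻¹))) := by group
          _ = g⁻¹ * (a * g * (a⁻¹ * (a * (g⁻¹ * (b * g * b⁻¹)))) * a⁻¹) := by group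
          _ = g⁻¹ * (a * g * (a⁻¹ * (g⁻¹ * (b * g * b⁻¹) * a)) * a⁻¹) := by rw [h1]
          _ = g⁻¹ * (a * g * a⁻¹) * (g⁻¹ * (b * g * b⁻¹)) := by group) }
  have hf : f.range = ⊤ := by
    have : Fact (Nat.card Z).Prime := ⟨hp⟩
    refine (Subgroup.eq_bot_or_eq_top_of_prime_card f.range).resolve_left fun hbot => hg ?_
    rw [MonoidHom.range_eq_bot_iff] at hbot
    rw [Subgroup.mem_center_iff]
    intro h
    have h2 : g⁻¹ * (h * g * h⁻¹) = 1 := congrArg Subtype.val (DFunLike.congr_fun hbot h)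
    rw [inv_mul_eq_one, eq_mul_inv_iff_mul_eq] at h2
    exact h2.symm
  obtain ⟨h, hh⟩ := MonoidHom.range_eq_top.1 hf ⟨z, hz⟩
  exact ⟨h, by rw [← inv_mul_eq_iff_eq_mul]; exact congrArg Subtype.val hh⟩

theorem card_carrier_of_mem_noncenter {G : Type*} [Group G] {Z : Subgroup G} [Z.Normal]
    (hZ : Z ≤ Subgroup.center G) (hp : (Nat.card Z).Prime) (hab : ∀ a b : G ⧸ Z, a * b = b * a)
    {K : ConjClasses G} (hK : K ∈ ConjClasses.noncenter G) :
    Nat.card K.carrier = Nat.card Z := by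
  obtain ⟨g, rfl⟩ := ConjClasses.exists_rep K
  have hg : g ∉ Subgroup.center G := by
    intro h
    exact (ConjClasses.mk_bijOn G).mapsTo h hK
  have : (ConjClasses.mk g).carrier = (fun z : G => g * z) '' Z := by
    ext x
    rw [ConjClasses.mem_carrier_iff_mk_eq, eq_comm, ConjClasses.mk_eq_mk_iff_isConj, isConj_iff]
    constructor
    · rintro ⟨h, rfl⟩
      refine ⟨g⁻¹ * (h * g * h⁻¹), ?_, by group⟩
      rw [SetLike.mem_coe, ← QuotientGroup.eq_one_iff]
      have := hab h g
      simp [this]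
    · rintro ⟨z, hz, rfl⟩
      exact exists_conj_eq_mul hZ hp hab hg hz
  rw [this]
  exact Nat.card_image_of_injective (mul_right_injective g) _

theorem card_center_add_ncard_noncenter_mul {G : Type*} [Group G] [Finite G] {Z : Subgroup G}
    [Z.Normal] (hZ : Z ≤ Subgroup.center G) (hp : (Nat.card Z).Prime)
    (hab : ∀ a b : G ⧸ Z, a * b = b * a) :
    Nat.card (Subgroup.center G) + (ConjClasses.noncenter G).ncard * Nat.card Z = Nat.card G := by
  rw [← Group.nat_card_center_add_sum_card_noncenter_eq_card (G := G),
    finsum_mem_congr rfl fun K hK => card_carrier_of_mem_noncenter hZ hp hab hK,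
    finsum_mem_eq_finite_toFinset_sum _ (Set.toFinite _), Finset.sum_const, smul_eq_mul,
    Set.ncard_eq_toFinset_card _ (Set.toFinite _)]

theorem finprod_card_carrier {G : Type*} [Group G] [Finite G] {Z : Subgroup G}
    [Z.Normal] (hZ : Z ≤ Subgroup.center G) (hp : (Nat.card Z).Prime)
    (hab : ∀ a b : G ⧸ Z, a * b = b * a) :
    ∏ᶠ K : ConjClasses G, (Nat.card K.carrier : ℂ) =
      (Nat.card Z : ℂ) ^ (ConjClasses.noncenter G).ncard := by
  have h1 : ∏ᶠ K : ConjClasses G, (Nat.card K.carrier : ℂ) =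
      ∏ᶠ K ∈ ConjClasses.noncenter G, (Nat.card K.carrier : ℂ) := by
    rw [← finprod_mem_univ]
    -- Classes of central elements are singletons and contribute the factor 1.
    refine finprod_mem_inter_mulSupport_eq' _ _ _ fun K hK => ⟨fun _ => ?_, fun _ => trivial⟩
    by_contra hn
    rw [ConjClasses.mem_noncenter, Set.not_nontrivial_iff] at hn
    obtain ⟨g, rfl⟩ := ConjClasses.exists_rep K
    refine hK ?_
    beta_reduce
    rw [hn.eq_singleton_of_mem ConjClasses.mem_carrier_mk]
    simp
  rw [h1, finprod_mem_congr rfl fun K hK => by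
      rw [card_carrier_of_mem_noncenter hZ hp hab hK],
    finprod_mem_eq_finite_toFinset_prod _ (Set.toFinite _), Finset.prod_const,
    Set.ncard_eq_toFinset_card _ (Set.toFinite _)]

/-! ### Irreducible characters and their degrees. -/

open Classical in
/-- The function on `G` which vanishes off the center and is `d` times `l` on the center. -/
noncomputable def extendCentral {G : Type*} [Group G] (d : ℂ) (l : Subgroup.center G →* ℂˣ) (g : G) : ℂ :=
  if h : g ∈ Subgroup.center G then l ⟨g, h⟩ * d else 0

theorem extendCentral_one {G : Type*} [Group G] (d : ℂ) (l : Subgroup.center G →* ℂˣ) :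
    extendCentral d l 1 = d := by
  rw [extendCentral, dif_pos (one_mem _), show (⟨1, one_mem _⟩ : Subgroup.center G) = 1 from rfl,
    map_one, Units.val_one, one_mul]

theorem extendCentral_injective {G : Type*} [Group G] {d : ℂ} (hd : d ≠ 0) :
    Function.Injective (extendCentral d : (Subgroup.center G →* ℂˣ) → G → ℂ) := by
  intro l m h
  ext z
  have := congrFun h z
  rw [extendCentral, extendCentral, dif_pos z.2, dif_pos z.2] at this
  exact mul_right_cancel₀ hd this

theorem character_mul_center {G : Type*} [Group G] {n : ℕ} {ρ : Representation ℂ G (Fin n → ℂ)}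
    {l : Subgroup.center G →* ℂˣ} (hl : ∀ z : Subgroup.center G, ρ z = (l z : ℂ) • 1)
    (g : G) (z : Subgroup.center G) : ρ.character (g * z) = l z * ρ.character g := by
  rw [Representation.character, map_mul, hl, mul_smul_comm, mul_one, map_smul, smul_eq_mul]
  rfl

theorem character_one_eq {G : Type*} [Group G] {n : ℕ} (ρ : Representation ℂ G (Fin n → ℂ)) :
    ρ.character 1 = n := by
  simp

theorem character_eq_extendCentral {G : Type*} [Group G] {Z : Subgroup G} [Z.Normal]
    (hZ : Z ≤ Subgroup.center G) (hp : (Nat.card Z).Prime) (hab : ∀ a b : G ⧸ Z, a * b = b * a)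
    {n : ℕ} {ρ : Representation ℂ G (Fin n → ℂ)} {l : Subgroup.center G →* ℂˣ}
    (hl : ∀ z : Subgroup.center G, ρ z = (l z : ℂ) • 1)
    (hlZ : l ∉ (MonoidHom.domRestrictHom (Z.subgroupOf (Subgroup.center G)) ℂˣ).ker) :
    ρ.character = extendCentral n l := by
  funext g
  by_cases hg : g ∈ Subgroup.center G
  · have := character_mul_center hl 1 ⟨g, hg⟩
    rw [one_mul, character_one_eq] at this
    rw [extendCentral, dif_pos hg, this]
  · rw [extendCentral, dif_neg hg]
    obtain ⟨z, hz, hlz⟩ : ∃ z : Subgroup.center G, (z : G) ∈ Z ∧ l z ≠ 1 := by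
      by_contra! h
      refine hlZ ?_
      rw [MonoidHom.mem_ker]
      ext z
      exact congrArg Units.val (h z z.2)
    obtain ⟨h, hh⟩ := exists_conj_eq_mul hZ hp hab hg hz
    have h1 := character_mul_center hl g z
    rw [← hh, Representation.char_conj] at h1
    by_contra h0
    exact hlz (Units.ext (mul_right_cancel₀ h0 (by rw [← h1, Units.val_one, one_mul])))

/-- This is `⟨χ, χ⟩ = 1`: each central element contributes `n²` because `l z * l z⁻¹ = 1`, and all
others contribute 0. -/
theorem sq_mul_card_center {G : Type*} [Group G] [Finite G] {n : ℕ}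
    {ρ : Representation ℂ G (Fin n → ℂ)} [ρ.IsIrreducible] {l : Subgroup.center G →* ℂˣ}
    (h : ρ.character = extendCentral n l) :
    n ^ 2 * Nat.card (Subgroup.center G) = Nat.card G := by
  classical
  have := Fintype.ofFinite G
  have hc : (Nat.card G : ℂ) ≠ 0 := by
    exact_mod_cast (Nat.card_pos (α := G)).ne'
  let _ : Invertible (Nat.card G : ℂ) := invertibleOfNonzero hc
  have h1 := Representation.char_orthonormal ρ ρ
  rw [if_pos ⟨Representation.Equiv.refl ρ⟩, inv_mul_eq_one₀ hc] at h1
  have h2 : ∀ g : G, ρ.character g * ρ.character g⁻¹ =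
      if g ∈ Subgroup.center G then (n : ℂ) ^ 2 else 0 := by
    intro g
    rw [h]
    split_ifs with hg
    · have hg' := inv_mem hg
      rw [extendCentral, extendCentral, dif_pos hg, dif_pos hg',
        show (⟨g⁻¹, hg'⟩ : Subgroup.center G) = (⟨g, hg⟩ : Subgroup.center G)⁻¹ from rfl, map_inv,
        mul_mul_mul_comm, Units.mul_inv, one_mul, sq]
    · rw [extendCentral, dif_neg hg, zero_mul]
  simp only [h2] at h1
  rw [← Finset.sum_filter, Finset.sum_const, nsmul_eq_mul, ← Fintype.card_subtype,
    ← Nat.card_eq_fintype_card, mul_comm] at h1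
  exact_mod_cast h1.symm

theorem degree_eq_one_of_mem_ker {G : Type*} [Group G] {Z : Subgroup G} [Z.Normal]
    (hZ : Z ≤ Subgroup.center G) (hab : ∀ a b : G ⧸ Z, a * b = b * a)
    {n : ℕ} {ρ : Representation ℂ G (Fin n → ℂ)} [ρ.IsIrreducible] {l : Subgroup.center G →* ℂˣ}
    (hl : ∀ z : Subgroup.center G, ρ z = (l z : ℂ) • 1)
    (hlZ : l ∈ (MonoidHom.domRestrictHom (Z.subgroupOf (Subgroup.center G)) ℂˣ).ker) :
    n = 1 := by
  have htriv : ∀ z ∈ Z, ρ z = 1 := by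
    intro z hz
    have h1 : l ⟨z, hZ hz⟩ = 1 := DFunLike.congr_fun (MonoidHom.mem_ker.1 hlZ) ⟨⟨z, hZ hz⟩, hz⟩
    rw [show z = ((⟨z, hZ hz⟩ : Subgroup.center G) : G) from rfl, hl, h1, Units.val_one, one_smul]
  have hcomm : ∀ a b, ρ a * ρ b = ρ b * ρ a := by
    intro a b
    have hmem : (b * a)⁻¹ * (a * b) ∈ Z := by
      rw [← QuotientGroup.eq_one_iff]
      have := hab a b
      simp only [QuotientGroup.mk_mul, QuotientGroup.mk_inv, this, inv_mul_cancel]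
    rw [← map_mul, ← map_mul, ← mul_inv_cancel_left (b * a) (a * b), map_mul ρ (b * a),
      htriv _ hmem, mul_one]
  simpa using finrank_eq_one_of_forall_commute ρ hcomm

/-- Characters of `A` trivial on `H` are the characters of `A ⧸ H`, and a finite abelian group has
as many characters as elements. -/
theorem ncard_compl_ker_domRestrictHom {A : Type*} [CommGroup A] [Finite A] (H : Subgroup A) :
    ((MonoidHom.domRestrictHom H ℂˣ).ker : Set (A →* ℂˣ))ᶜ.ncard + Nat.card (A ⧸ H) =
      Nat.card A := by
  have hfin : Finite (A →* ℂˣ) := by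
    obtain ⟨e⟩ := CommGroup.monoidHom_mulEquiv_of_hasEnoughRootsOfUnity A ℂ
    exact Finite.of_equiv _ e.symm.toEquiv
  rw [← CommGroup.card_domRestrictHom_ker ℂ H,
    ← CommGroup.card_monoidHom_of_hasEnoughRootsOfUnity A ℂ, add_comm]
  exact Set.ncard_add_ncard_compl _

theorem finprod_degree {G : Type*} [Group G] [Finite G] {Z : Subgroup G} [Z.Normal]
    (hZ : Z ≤ Subgroup.center G) (hp : (Nat.card Z).Prime) (hab : ∀ a b : G ⧸ Z, a * b = b * a) :
    ∏ᶠ χ ∈ irrChar G, χ 1 = ((√(Nat.card (G ⧸ Subgroup.center G)) : ℝ) : ℂ) ^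
      ((MonoidHom.domRestrictHom (Z.subgroupOf (Subgroup.center G)) ℂˣ).ker :
        Set (Subgroup.center G →* ℂˣ))ᶜ.ncard := by
  set S : Set (Subgroup.center G →* ℂˣ) :=
    ((MonoidHom.domRestrictHom (Z.subgroupOf (Subgroup.center G)) ℂˣ).ker :
      Set (Subgroup.center G →* ℂˣ))ᶜ with hS
  set d : ℂ := ((√(Nat.card (G ⧸ Subgroup.center G)) : ℝ) : ℂ) with hd
  have hd0 : d ≠ 0 := by
    rw [hd, Complex.ofReal_ne_zero]
    exact (Real.sqrt_pos.2 (Nat.cast_pos.2 Nat.card_pos)).ne'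
  have hchar : ∀ {n : ℕ} {ρ : Representation ℂ G (Fin n → ℂ)} {l : Subgroup.center G →* ℂˣ},
      ρ.IsIrreducible → (∀ z : Subgroup.center G, ρ z = (l z : ℂ) • 1) → l ∈ S →
      ρ.character = extendCentral d l := by
    intro n ρ l hρ hl hlS
    have h1 := character_eq_extendCentral hZ hp hab hl hlS
    have h2 := sq_mul_card_center h1
    rw [Subgroup.card_eq_card_quotient_mul_card_subgroup (Subgroup.center G)] at h2
    have h3 := Nat.eq_of_mul_eq_mul_right Nat.card_pos h2
    have h4 : d = n := by
      rw [hd, ← h3, Nat.cast_pow, Real.sqrt_sq (Nat.cast_nonneg n), Complex.ofReal_natCast]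
    rw [h1, h4]
  have himage : extendCentral d '' S ⊆ irrChar G := by
    rintro _ ⟨l, hlS, rfl⟩
    obtain ⟨n, ρ, hρ, hl⟩ := exists_irreducible_of_centralCharacter l
    exact ⟨n, ρ, hρ, (hchar hρ hl hlS).symm⟩
  have hSfin : S.Finite := by
    refine Set.Finite.of_finite_image ((irrChar_finite G).subset himage)
      (extendCentral_injective hd0).injOn
  -- Only characters of degree other than 1 matter; each of these is `extendCentral d l` for an `l`
  -- nontrivial on `Z`.
  rw [finprod_mem_inter_mulSupport_eq' (fun χ : G → ℂ => χ 1) (irrChar G) (extendCentral d '' S),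
    finprod_mem_image (extendCentral_injective hd0).injOn]
  · simp only [extendCentral_one]
    rw [finprod_mem_eq_finite_toFinset_prod _ hSfin, Finset.prod_const,
      Set.ncard_eq_toFinset_card _ hSfin]
  · intro χ hχ
    refine ⟨?_, fun h => himage h⟩
    rintro ⟨n, ρ, hρ, rfl⟩
    obtain ⟨l, hl⟩ := exists_centralCharacter ρ
    by_cases hlS : l ∈ S
    · exact ⟨l, hlS, (hchar hρ hl hlS).symm⟩
    · refine absurd ?_ hχ
      rw [hS, Set.notMem_compl_iff] at hlS
      beta_reduce
      rw [character_one_eq, degree_eq_one_of_mem_ker hZ hab hl hlS, Nat.cast_one]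

/-! ### The formula for Harada's number. -/

theorem haradaNumber_eq_rpow {G : Type*} [Group G] [Finite G] {p : ℕ} (hp : p.Prime)
    {Z : Subgroup G} [Z.Normal] (hZ : Z ≤ Subgroup.center G) (hcard : Nat.card Z = p)
    (hab : ∀ a b : G ⧸ Z, a * b = b * a) {s : ℕ}
    (hs : Nat.card (G ⧸ Subgroup.center G) = p ^ s) :
    haradaNumber G = (((p : ℝ) ^ (((p : ℝ) - 1) * (2 * pInt p s - (s : ℝ)) / 2 *
      (Nat.card (Subgroup.center G ⧸ Z.subgroupOf (Subgroup.center G)) : ℝ)) : ℝ) : ℂ) := by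
  have hp' : (Nat.card Z).Prime := hcard ▸ hp
  have hp0 : (0 : ℝ) < p := Nat.cast_pos.2 hp.pos
  have hp1 : (p : ℝ) - 1 ≠ 0 := sub_ne_zero.2 (Nat.cast_ne_one.2 hp.one_lt.ne')
  rw [haradaNumber, finprod_card_carrier hZ hp' hab, finprod_degree hZ hp' hab, hs, hcard]
  have h1 := card_center_add_ncard_noncenter_mul hZ hp' hab
  have h2 := open scoped IsMulCommutative in ncard_compl_ker_domRestrictHom (Z.subgroupOf (Subgroup.center G))
  have h3 := Subgroup.card_eq_card_quotient_mul_card_subgroup (Z.subgroupOf (Subgroup.center G))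
  have h4 := Subgroup.card_eq_card_quotient_mul_card_subgroup (Subgroup.center G)
  have h5 : Nat.card (Z.subgroupOf (Subgroup.center G)) = p := by
    rw [Nat.card_congr (Subgroup.subgroupOfEquivOfLe hZ).toEquiv, hcard]
  rw [h5] at h3
  rw [hs] at h4
  rw [hcard, h4] at h1
  -- With `m = |Z(G)/Z|`, there are `k = m(p^s - 1)` classes of size `p` and `t = m(p - 1)`
  -- characters of degree `p^(s/2)`. The exponent is `k - (s/2)t`; real exponents avoid proving `s`
  -- even.
  generalize (ConjClasses.noncenter G).ncard = k at *
  generalize Set.ncard _ = t at *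
  generalize Nat.card (Subgroup.center G ⧸ Z.subgroupOf (Subgroup.center G)) = m at *
  rw [h3] at h1 h2
  have h1' : (k : ℝ) = m * ((p : ℝ) ^ s - 1) := by
    have : ((m * p + k * p : ℕ) : ℝ) = (p ^ s * (m * p) : ℕ) := by rw [h1]
    push_cast at this
    have : (k : ℝ) * p = m * ((p : ℝ) ^ s - 1) * p := by linear_combination this
    exact mul_right_cancel₀ hp0.ne' this
  have h2' : (t : ℝ) = m * ((p : ℝ) - 1) := by
    have : ((t + m : ℕ) : ℝ) = (m * p : ℕ) := by rw [h2]
    push_cast at this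
    linear_combination this
  have h6 : √((p ^ s : ℕ) : ℝ) = (p : ℝ) ^ ((s : ℝ) / 2) := by
    rw [Nat.cast_pow, Real.sqrt_eq_rpow, ← Real.rpow_natCast, ← Real.rpow_mul hp0.le]
    ring_nf
  rw [h6, ← Complex.ofReal_natCast, ← Complex.ofReal_pow, ← Complex.ofReal_pow,
    ← Complex.ofReal_div, ← Real.rpow_natCast, ← Real.rpow_natCast, ← Real.rpow_mul hp0.le,
    ← Real.rpow_sub hp0, h1', h2', pInt]
  congr 2
  field_simp

/-! ### Consequences of the relations of `M(p^d)`, with `q` for `p^(d-2)`. -/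

section MetacyclicRelations

variable {H : Type*} [Group H] {x y : H} {p q : ℕ}

theorem pow_mul_of_conj (hxy : y⁻¹ * x * y = x ^ (1 + q)) (k : ℕ) :
    x ^ k * y = y * x ^ (k * (1 + q)) := by
  have : (y⁻¹ * x * y) ^ k = y⁻¹ * x ^ k * y := by
    simpa using conj_pow (i := k) (a := y⁻¹) (b := x)
  rw [mul_comm k, pow_mul, ← hxy, this]
  group

theorem exists_eq_pow_mul_pow (hp : 0 < p) (hq : 0 < q) (hx : x ^ (p * q) = 1) (hy : y ^ p = 1)
    (hxy : y⁻¹ * x * y = x ^ (1 + q)) (hgen : Subgroup.closure {x, y} = ⊤) (g : H) :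
    ∃ j < p, ∃ i < p * q, g = y ^ j * x ^ i := by
  suffices h : ∃ j i, g = y ^ j * x ^ i by
    obtain ⟨j, i, rfl⟩ := h
    exact ⟨j % p, Nat.mod_lt _ hp, i % (p * q), Nat.mod_lt _ (Nat.mul_pos hp hq), by
      rw [pow_eq_pow_mod j hy, pow_eq_pow_mod i hx]⟩
  have hmulx : ∀ g : H, (∃ j i, g = y ^ j * x ^ i) → ∀ k, ∃ j i, g * x ^ k = y ^ j * x ^ i := by
    rintro _ ⟨j, i, rfl⟩ k
    exact ⟨j, i + k, by rw [pow_add, mul_assoc]⟩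
  have hmuly : ∀ g : H, (∃ j i, g = y ^ j * x ^ i) → ∀ k, ∃ j i, g * y ^ k = y ^ j * x ^ i := by
    intro g hg k
    induction k with
    | zero => simpa using hg
    | succ k ih =>
      obtain ⟨j, i, h⟩ := ih
      exact ⟨j + 1, i * (1 + q), by
        rw [pow_succ, ← mul_assoc, h, mul_assoc, pow_mul_of_conj hxy, pow_succ, mul_assoc]⟩
  -- Inverses are positive powers, so natural number exponents suffice.
  have hxinv : x⁻¹ = x ^ (p * q - 1) := by
    rw [inv_eq_iff_mul_eq_one, ← pow_succ', Nat.sub_add_cancel (Nat.mul_pos hp hq), hx]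
  have hyinv : y⁻¹ = y ^ (p - 1) := by
    rw [inv_eq_iff_mul_eq_one, ← pow_succ', Nat.sub_add_cancel hp, hy]
  have hg : g ∈ Subgroup.closure {x, y} := hgen ▸ Subgroup.mem_top g
  induction hg using Subgroup.closure_induction_right with
  | one => exact ⟨0, 0, by simp⟩
  | mul_right a _ b hb ih =>
    obtain rfl | rfl := hb
    · simpa using hmulx a ih 1
    · simpa using hmuly a ih 1
  | mul_inv_cancel a _ b hb ih =>
    obtain rfl | rfl := hb
    · rw [hxinv]
      exact hmulx a ih _
    · rw [hyinv]
      exact hmuly a ih _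

/-- Moving `x^k` past `y` multiplies it by `x^(kq)`, which is trivial when `p` divides `k`. -/
theorem pow_mem_center (hp : 0 < p) (hq : 0 < q) (hx : x ^ (p * q) = 1) (hy : y ^ p = 1)
    (hxy : y⁻¹ * x * y = x ^ (1 + q)) (hgen : Subgroup.closure {x, y} = ⊤) {k : ℕ} (hk : p ∣ k) :
    x ^ k ∈ Subgroup.center H := by
  have h1 : Commute (x ^ k) y := by
    obtain ⟨c, rfl⟩ := hk
    rw [Commute, SemiconjBy, pow_mul_of_conj hxy, mul_add, mul_one, pow_add,
      show p * c * q = p * q * c by ring, pow_mul x (p * q), hx, one_pow, mul_one]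
  rw [Subgroup.mem_center_iff]
  intro g
  obtain ⟨j, -, i, -, rfl⟩ := exists_eq_pow_mul_pow hp hq hx hy hxy hgen g
  exact ((h1.pow_right j).mul_right (Commute.pow_pow_self x k i)).eq.symm

theorem commute_quotient_zpowers (hp : 0 < p) (hq : 0 < q) (hx : x ^ (p * q) = 1)
    (hy : y ^ p = 1) (hxy : y⁻¹ * x * y = x ^ (1 + q)) (hgen : Subgroup.closure {x, y} = ⊤)
    [(Subgroup.zpowers (x ^ q)).Normal] (a b : H ⧸ Subgroup.zpowers (x ^ q)) :
    a * b = b * a := by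
  obtain ⟨g, rfl⟩ := QuotientGroup.mk_surjective a
  obtain ⟨h, rfl⟩ := QuotientGroup.mk_surjective b
  obtain ⟨j, -, i, -, rfl⟩ := exists_eq_pow_mul_pow hp hq hx hy hxy hgen g
  obtain ⟨l, -, k, -, rfl⟩ := exists_eq_pow_mul_pow hp hq hx hy hxy hgen h
  have hc : Commute (x : H ⧸ Subgroup.zpowers (x ^ q)) y := by
    have h1 := pow_mul_of_conj hxy 1
    rw [one_mul, pow_one, pow_add, pow_one] at h1
    rw [Commute, SemiconjBy, ← QuotientGroup.mk_mul, h1, QuotientGroup.mk_mul,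
      QuotientGroup.mk_mul, (QuotientGroup.eq_one_iff _).2 (Subgroup.mem_zpowers (x ^ q)), mul_one]
  simp only [QuotientGroup.mk_mul, QuotientGroup.mk_pow]
  exact Commute.eq (((Commute.pow_pow_self _ j l).mul_right (hc.pow_pow k j).symm).mul_left
    ((hc.pow_pow i l).mul_right (Commute.pow_pow_self _ i k)))

end MetacyclicRelations

/-! ### A permutation model of `M(p^d)` on the integers mod `pq`. -/

/-- Multiplication by `1 - c`, for `c` of square zero. -/
def mulOneSub {R : Type*} [CommRing R] (c : R) (hc : c * c = 0) : Equiv.Perm R where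
  toFun t := (1 - c) * t
  invFun t := (1 + c) * t
  left_inv t := by linear_combination (-t) * hc
  right_inv t := by linear_combination (-t) * hc

theorem mulOneSub_pow_apply {R : Type*} [CommRing R] (c : R) (hc : c * c = 0) (j : ℕ) (t : R) :
    (mulOneSub c hc ^ j) t = (1 - j * c) * t := by
  induction j with
  | zero => simp
  | succ j ih =>
    rw [pow_succ', Equiv.Perm.mul_apply, ih]
    change (1 - c) * ((1 - j * c) * t) = _
    push_cast
    linear_combination (j * t) * hc

theorem addRight_one_pow_apply {R : Type*} [CommRing R] (i : ℕ) (t : R) :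
    ((Equiv.addRight (1 : R)) ^ i) t = t + i := by
  induction i with
  | zero => simp
  | succ i ih =>
    rw [pow_succ', Equiv.Perm.mul_apply, ih]
    simp [add_assoc]

/-- Conjugation turns translation by 1 into translation by `(1 - q)⁻¹ = 1 + q`, which is why `y`
acts as `1 - q`. -/
theorem mulOneSub_conj {R : Type*} [CommRing R] (q : ℕ) (hc : (q : R) * q = 0) :
    (mulOneSub (q : R) hc)⁻¹ * Equiv.addRight (1 : R) * mulOneSub (q : R) hc =
      Equiv.addRight (1 : R) ^ (1 + q) := by
  ext t
  rw [addRight_one_pow_apply]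
  change (1 + (q : R)) * ((1 - q) * t + 1) = _
  push_cast
  linear_combination (-t) * hc

/-- An affine map determines its slope, hence `jq` mod `pq` and so `j < p`; cancelling the unit `1 -
jq` then recovers `i`. -/
theorem eq_of_perm_pow_mul_pow_eq {p q : ℕ} (hq : 0 < q)
    (hc : (q : ZMod (p * q)) * q = 0) {j i j' i' : ℕ} (hj : j < p) (hj' : j' < p)
    (hi : i < p * q) (hi' : i' < p * q)
    (h : mulOneSub (q : ZMod (p * q)) hc ^ j * Equiv.addRight 1 ^ i =
      mulOneSub (q : ZMod (p * q)) hc ^ j' * Equiv.addRight 1 ^ i') : j = j' ∧ i = i' := by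
  have h1 : ∀ t : ZMod (p * q), (1 - j * q) * (t + i) = (1 - j' * q) * (t + i') := by
    intro t
    have := congrArg (fun f : Equiv.Perm (ZMod (p * q)) => f t) h
    simpa only [Equiv.Perm.mul_apply, addRight_one_pow_apply, mulOneSub_pow_apply] using this
  have h2 : ((j * q : ℕ) : ZMod (p * q)) = (j' * q : ℕ) := by
    push_cast
    linear_combination h1 0 - h1 1
  have hjj : j = j' := by
    rw [ZMod.natCast_eq_natCast_iff'] at h2
    rw [Nat.mod_eq_of_lt (Nat.mul_lt_mul_of_pos_right hj hq),
      Nat.mod_eq_of_lt (Nat.mul_lt_mul_of_pos_right hj' hq)] at h2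
    exact Nat.eq_of_mul_eq_mul_right hq h2
  refine ⟨hjj, ?_⟩
  subst hjj
  have h3 : (i : ZMod (p * q)) = i' := by
    linear_combination (1 + (j : ZMod (p * q)) * q) * h1 0 + (j : ZMod (p * q)) ^ 2 * (i - i') * hc
  rw [ZMod.natCast_eq_natCast_iff', Nat.mod_eq_of_lt hi, Nat.mod_eq_of_lt hi'] at h3
  exact h3

/-! ### Harada's number of `M(p^d)`. -/

/-- Harada's number of a group with the defining relations of `M(p ^ d)` in which the normal form
`y ^ j * x ^ i` is unique. -/
theorem haradaNumber_of_metacyclic {H : Type*} [Group H] {x y : H} {p m : ℕ} (hp : p.Prime)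
    (hm : 0 < m) (hx : x ^ (p * (p * m)) = 1) (hy : y ^ p = 1)
    (hxy : y⁻¹ * x * y = x ^ (1 + p * m)) (hgen : Subgroup.closure {x, y} = ⊤)
    (hinj : ∀ j < p, ∀ j' < p, ∀ i < p * (p * m), ∀ i' < p * (p * m),
      y ^ j * x ^ i = y ^ j' * x ^ i' → j = j' ∧ i = i') :
    Finite H ∧ haradaNumber H = (p : ℂ) ^ (p * m * (p - 1)) := by
  have hq : 0 < p * m := Nat.mul_pos hp.pos hm
  let f : Fin p × Fin (p * (p * m)) → H := fun a => y ^ (a.1 : ℕ) * x ^ (a.2 : ℕ)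
  have hf : Function.Bijective f := by
    constructor
    · rintro ⟨j, i⟩ ⟨j', i'⟩ h
      obtain ⟨h1, h2⟩ := hinj j j.2 j' j'.2 i i.2 i' i'.2 h
      exact Prod.ext (Fin.ext h1) (Fin.ext h2)
    · intro g
      obtain ⟨j, hj, i, hi, rfl⟩ := exists_eq_pow_mul_pow hp.pos hq hx hy hxy hgen g
      exact ⟨(⟨j, hj⟩, ⟨i, hi⟩), rfl⟩
  have hfin : Finite H := Finite.of_surjective f hf.2
  have hcard : Nat.card H = p ^ 2 * (p * m) := by
    rw [← Nat.card_eq_of_bijective f hf, Nat.card_prod, Nat.card_fin, Nat.card_fin]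
    ring
  have hord : orderOf x = p * (p * m) := by
    rw [orderOf_eq_iff (Nat.mul_pos hp.pos hq)]
    refine ⟨hx, fun i hi hi0 h => ?_⟩
    have := (hinj 0 hp.pos 0 hp.pos i hi 0 (Nat.mul_pos hp.pos hq) (by simpa using h)).2
    omega
  have hcentral : ∀ {k}, p ∣ k → x ^ k ∈ Subgroup.center H :=
    fun hk => pow_mem_center hp.pos hq hx hy hxy hgen hk
  have hcenter : Nat.card (Subgroup.zpowers (x ^ p)) = p * m := by
    rw [Nat.card_zpowers, orderOf_pow_of_dvd hp.ne_zero (hord ▸ Dvd.intro _ rfl), hord,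
      Nat.mul_div_cancel_left _ hp.pos]
  have hZcard : Nat.card (Subgroup.zpowers (x ^ (p * m))) = p := by
    rw [Nat.card_zpowers, orderOf_pow_of_dvd hq.ne' (hord ▸ Dvd.intro_left _ rfl), hord,
      Nat.mul_div_cancel _ hq]
  have hZ : Subgroup.zpowers (x ^ (p * m)) ≤ Subgroup.center H :=
    Subgroup.zpowers_le.2 (hcentral (Dvd.intro _ rfl))
  have hnormal : (Subgroup.zpowers (x ^ (p * m))).Normal :=
    ⟨fun z hz g => by rwa [Subgroup.mem_center_iff.1 (hZ hz) g, mul_inv_cancel_right]⟩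
  have hmul := Subgroup.card_eq_card_quotient_mul_card_subgroup (Subgroup.center H)
  -- `a` is the index of `⟨x^p⟩` in the center; it will turn out to be 1.
  obtain ⟨a, ha⟩ : p * m ∣ Nat.card (Subgroup.center H) := hcenter ▸
    Subgroup.card_dvd_of_le (Subgroup.zpowers_le.2 (hcentral dvd_rfl))
  have hmul' : Nat.card (H ⧸ Subgroup.center H) * a = p ^ 2 := by
    rw [hcard, ha] at hmul
    exact Nat.eq_of_mul_eq_mul_right hq (by rw [hmul]; ring)
  have hs : Nat.card (H ⧸ Subgroup.center H) = p ^ 2 := by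
    obtain ⟨k, hk, hk'⟩ := (Nat.dvd_prime_pow hp).1 (Dvd.intro _ hmul')
    obtain rfl | hk1 := hk.eq_or_lt
    · exact hk'
    -- A central quotient of order dividing `p` is cyclic, so `x` and `y` would commute and `x^(pm)
    -- = 1`, against the order of `Z`.
    have : Fact p.Prime := ⟨hp⟩
    have hcyc : IsCyclic (H ⧸ Subgroup.center H) := by
      refine isCyclic_of_card_dvd_prime (p := p) ?_
      rw [hk']
      exact (pow_dvd_pow p (Nat.le_of_lt_succ hk1)).trans (pow_one p).dvd
    have hcomm := (MonoidHom.isMulCommutative_of_isCyclic_of_ker_le_center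
      (QuotientGroup.mk' (Subgroup.center H)) (by rw [QuotientGroup.ker_mk'])).is_comm.comm x y
    rw [mul_assoc, hcomm, inv_mul_cancel_left, pow_add, pow_one, left_eq_mul] at hxy
    rw [hxy, Subgroup.zpowers_one_eq_bot, Subgroup.card_bot] at hZcard
    exact absurd hZcard.symm hp.one_lt.ne'
  have ha1 : a = 1 := by
    rw [hs] at hmul'
    exact Nat.eq_of_mul_eq_mul_left (pow_pos hp.pos 2) (by rw [hmul', mul_one])
  have hquot : Nat.card (Subgroup.center H ⧸
      (Subgroup.zpowers (x ^ (p * m))).subgroupOf (Subgroup.center H)) = m := by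
    have h3 := Subgroup.card_eq_card_quotient_mul_card_subgroup
      ((Subgroup.zpowers (x ^ (p * m))).subgroupOf (Subgroup.center H))
    rw [Nat.card_congr (Subgroup.subgroupOfEquivOfLe hZ).toEquiv, hZcard, ha, ha1, mul_one] at h3
    exact Nat.eq_of_mul_eq_mul_right hp.pos (by rw [← h3, mul_comm])
  refine ⟨hfin, ?_⟩
  rw [haradaNumber_eq_rpow hp hZ hZcard
    (commute_quotient_zpowers hp.pos hq hx hy hxy hgen) hs, hquot]
  have hp1 : (p : ℝ) - 1 ≠ 0 := sub_ne_zero.2 (Nat.cast_ne_one.2 hp.one_lt.ne')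
  -- Here `[2]_p = p + 1`, so `(2[2]_p - 2)/2 = p`.
  have hexp : ((p : ℝ) - 1) * (2 * pInt p 2 - (2 : ℕ)) / 2 * m = (p * m * (p - 1) : ℕ) := by
    rw [pInt]
    push_cast [Nat.cast_sub hp.one_le]
    field_simp
    ring
  rw [hexp, Real.rpow_natCast]
  push_cast
  rfl

theorem modularPGroup_finite_and_haradaNumber {p d : ℕ} (hp : p.Prime) (hd : 2 < d) :
    Finite (ModularPGroup p d) ∧
      haradaNumber (ModularPGroup p d) = (p : ℂ) ^ (p ^ (d - 2) * (p - 1)) := by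
  obtain ⟨e, rfl⟩ : ∃ e, d = e + 3 := ⟨d - 3, by omega⟩
  have hq : p ^ (e + 3 - 2) = p * p ^ e := by
    rw [show e + 3 - 2 = e + 1 by omega, pow_succ']
  have hN : p ^ (e + 3 - 1) = p * (p * p ^ e) := by
    rw [show e + 3 - 1 = e + 2 by omega, pow_succ', pow_succ']
  have hm : 0 < p ^ e := pow_pos hp.pos e
  let x : ModularPGroup p (e + 3) := PresentedGroup.of 0
  let y : ModularPGroup p (e + 3) := PresentedGroup.of 1
  have hx : x ^ (p * (p * p ^ e)) = 1 := by
    rw [← hN]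
    exact PresentedGroup.one_of_mem (Or.inl rfl)
  have hy : y ^ p = 1 := PresentedGroup.one_of_mem (Or.inr (Or.inl rfl))
  have hxy : y⁻¹ * x * y = x ^ (1 + p * p ^ e) := by
    rw [← hq, ← mul_inv_eq_one]
    exact PresentedGroup.one_of_mem (Or.inr (Or.inr rfl))
  have hgen : Subgroup.closure {x, y} = ⊤ := by
    rw [← PresentedGroup.closure_range_of]
    congr 1
    ext g
    simp [Fin.exists_fin_two, x, y, eq_comm]
  -- The square of `q` vanishes mod `pq` because `p` divides `q`, which is where `d > 2` enters.
  have hc : ((p * p ^ e : ℕ) : ZMod (p * (p * p ^ e))) * (p * p ^ e : ℕ) = 0 := by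
    rw [← Nat.cast_mul, ZMod.natCast_eq_zero_iff]
    exact ⟨p ^ e, by ring⟩
  let u : Fin 2 → Equiv.Perm (ZMod (p * (p * p ^ e))) := ![Equiv.addRight 1, mulOneSub _ hc]
  have hcast : ((p * (p * p ^ e) : ℕ) : ZMod (p * (p * p ^ e))) = 0 := ZMod.natCast_self _
  have hu0 : FreeGroup.lift u (FreeGroup.of 0) = Equiv.addRight 1 := by simp [u]
  have hu1 : FreeGroup.lift u (FreeGroup.of 1) = mulOneSub _ hc := by simp [u]
  have hrel : ∀ r ∈ ({FreeGroup.of 0 ^ p ^ (e + 3 - 1), FreeGroup.of 1 ^ p,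
      ((FreeGroup.of 1)⁻¹ * FreeGroup.of 0 * FreeGroup.of 1) *
        (FreeGroup.of 0 ^ (1 + p ^ (e + 3 - 2)))⁻¹} : Set (FreeGroup (Fin 2))),
      FreeGroup.lift u r = 1 := by
    rintro r (rfl | rfl | rfl)
    · rw [map_pow, hu0, hN]
      ext1 t
      rw [addRight_one_pow_apply, hcast, add_zero, Equiv.Perm.one_apply]
    · rw [map_pow, hu1]
      ext1 t
      rw [mulOneSub_pow_apply, ← Nat.cast_mul, hcast, sub_zero, one_mul, Equiv.Perm.one_apply]
    · rw [map_mul, map_mul, map_mul, map_inv, map_inv, map_pow, hu0, hu1, hq, mul_inv_eq_one]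
      exact mulOneSub_conj _ hc
  -- This action separates the normal forms, so the presented group does not collapse.
  let φ : ModularPGroup p (e + 3) →* Equiv.Perm (ZMod (p * (p * p ^ e))) :=
    PresentedGroup.toGroup hrel
  have hφx : φ x = Equiv.addRight 1 := PresentedGroup.toGroup.of hrel
  have hφy : φ y = mulOneSub _ hc := PresentedGroup.toGroup.of hrel
  have hexp : (p : ℂ) ^ (p ^ (e + 3 - 2) * (p - 1)) = (p : ℂ) ^ (p * p ^ e * (p - 1)) := by rw [hq]
  rw [hexp]
  refine haradaNumber_of_metacyclic hp hm hx hy hxy hgen fun j hj j' hj' i hi i' hi' h => ?_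
  have h1 := congrArg φ h
  rw [map_mul, map_mul, map_pow, map_pow, map_pow, map_pow, hφx, hφy] at h1
  exact eq_of_perm_pow_mul_pow_eq (Nat.mul_pos hp.pos hm) hc hj hj' hi hi' h1

theorem mainTheorem10 (p : ℕ) (hp : p.Prime) :
    (∀ (G : Type*) [Group G] [Finite G], IsPGroup p G →
      ∀ (Z : Subgroup G) [Z.Normal], Z ≤ Subgroup.center G → Nat.card Z = p →
        (∀ a b : G ⧸ Z, a * b = b * a) →
        ∀ s : ℕ, Nat.card (G ⧸ Subgroup.center G) = p ^ s →
          haradaNumber G =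
            (((p : ℝ) ^ (((p : ℝ) - 1) * (2 * pInt p s - (s : ℝ)) / 2 *
              (Nat.card (Subgroup.center G ⧸ Z.subgroupOf (Subgroup.center G)) : ℝ)) : ℝ) : ℂ)) ∧
    (∀ d : ℕ, 2 < d →
      Finite (ModularPGroup p d) ∧
        haradaNumber (ModularPGroup p d) = (p : ℂ) ^ (p ^ (d - 2) * (p - 1))) := by
  refine ⟨fun G _ _ _ Z _ hZ hcard hab s hs => haradaNumber_eq_rpow hp hZ hcard hab hs,
    fun d hd => modularPGroup_finite_and_haradaNumber hp hd⟩
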